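/- Let $d\ge 1$. For $f:\mathbb{Z}^d\to\mathbb{R}$ in $\ell^1(\mathbb{Z}^d)$, let $$\widetilde M f(n)=\sup_{Q\ni n}\frac{1}{|Q\cap\mathbb{Z}^d|}\sum_{m\in Q\cap\mathbb{Z}^d}|f(m)|,\qquad n\in\mathbb{Z}^d,$$ where the supremum is over all closed cubes $Q=\{x\in\mathbb{R}^d:\|x-x_0\|_\infty\le r\}$ with $x_0\in\mathbb{R}^d$, $r\ge 0$ and $n\in Q$, and for $g:\mathbb{Z}^d\to\mathbb{R}$ let $$\operatorname{Var} g=\sum_{i=1}^d\sum_{n\in\mathbb{Z}^d}|g(n+e_i)-g(n)|\in[0,\infty],$$ where $e_1,\dots,e_d$ are the canonical basis vectors. Put $$\widetilde C(d)=2d\left(1+\sum_{k\ge 1}\frac1k\left[\left(\frac{2}{k+1}+\frac{2k-1}{k}\right)^{d-1}-\left(\frac{2k-1}{k}\right)^{d-1}\right]\right).$$ This series converges, and for every $f\in\ell^1(\mathbb{Z}^d)$, $$\operatorname{Var}\widetilde M f\le \widetilde C(d)\,\|f\|_{\ell^1(\mathbb{Z}^d)}.$$ The constant $\widetilde C(d)$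 is the best possible: if $C\in\mathbb{R}$ is such that $\operatorname{Var}\widetilde M f\le C\|f\|_{\ell^1(\mathbb{Z}^d)}$ for all $f\in\ell^1(\mathbb{Z}^d)$, then $\widetilde C(d)\le C$. Moreover, for $f\in\ell^1(\mathbb{Z}^d)$, equality $\operatorname{Var}\widetilde M f=\widetilde C(d)\|f\|_{\ell^1(\mathbb{Z}^d)}$ holds if and only if $f$ is a delta function, that is, there are $p\in\mathbb{Z}^d$ and $k\in\mathbb{R}$ with $f(p)=k$ and $f(n)=0$ for all $n\ne p$. In particular, $\widetilde C(1)=2$ and $\widetilde C(2)=12$. -/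

import Mathlib

open scoped ENNReal

/-- The lattice point `n ∈ ℤ^d` as a point of `ℝ^d`; `Fin d → ℝ` carries the sup norm, so that
`Metric.closedBall x₀ r` is the closed cube with centre `x₀` and half-side `r`. -/
def latticePoint {d : ℕ} (n : Fin d → ℤ) : Fin d → ℝ := fun i => (n i : ℝ)

theorem finite_latticePoint_mem_closedBall {d : ℕ} (x₀ : Fin d → ℝ) (r : ℝ) :
    {m : Fin d → ℤ | latticePoint m ∈ Metric.closedBall x₀ r}.Finite := by
  refine (Set.finite_Icc (fun i => ⌈x₀ i - r⌉) (fun i => ⌊x₀ i + r⌋)).subset ?_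
  intro m hm
  have key : ∀ i, |(m i : ℝ) - x₀ i| ≤ r := fun i => by
    have h := (dist_le_pi_dist (latticePoint m) x₀ i).trans (Metric.mem_closedBall.mp hm)
    simpa [latticePoint, Real.dist_eq] using h
  refine ⟨fun i => Int.ceil_le.mpr ?_, fun i => Int.le_floor.mpr ?_⟩
  · linarith [(abs_le.mp (key i)).1]
  · linarith [(abs_le.mp (key i)).2]

/-- The lattice points of the closed cube with centre `x₀ ∈ ℝ^d` and half-side `r`. -/
noncomputable def cubePoints {d : ℕ} (x₀ : Fin d → ℝ) (r : ℝ) : Finset (Fin d → ℤ) :=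
  (finite_latticePoint_mem_closedBall x₀ r).toFinset

/-- The average of `|f|` over the lattice points of a closed cube. -/
noncomputable def cubeAverage {d : ℕ} (f : (Fin d → ℤ) → ℝ) (x₀ : Fin d → ℝ) (r : ℝ) : ℝ :=
  (1 / ((cubePoints x₀ r).card : ℝ)) * ∑ m ∈ cubePoints x₀ r, |f m|

/-- The averages of `|f|` over all closed cubes (real centre, real half-side `r ≥ 0`)
that contain the lattice point `n`. -/
def cubeAverages {d : ℕ} (f : (Fin d → ℤ) → ℝ) (n : Fin d → ℤ) : Set ℝ :=
  {a | ∃ (x₀ : Fin d → ℝ) (r : ℝ), 0 ≤ r ∧ latticePoint n ∈ Metric.closedBall x₀ r ∧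
    a = cubeAverage f x₀ r}

/-- The uncentered discrete maximal function over cubes. -/
noncomputable def uncenteredMaximal {d : ℕ} (f : (Fin d → ℤ) → ℝ) (n : Fin d → ℤ) : ℝ :=
  sSup (cubeAverages f n)

theorem cubeAverages_nonempty {d : ℕ} (f : (Fin d → ℤ) → ℝ) (n : Fin d → ℤ) :
    (cubeAverages f n).Nonempty :=
  ⟨_, latticePoint n, 0, le_rfl, by simp, rfl⟩

/-- For summable `f` the supremum in `uncenteredMaximal` is a genuine one. -/
theorem bddAbove_cubeAverages {d : ℕ} (f : (Fin d → ℤ) → ℝ) (hf : Summable fun m => |f m|)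
    (n : Fin d → ℤ) : BddAbove (cubeAverages f n) := by
  refine ⟨∑' m, |f m|, ?_⟩
  rintro a ⟨x₀, r, -, -, rfl⟩
  have h1 : ∑ m ∈ cubePoints x₀ r, |f m| ≤ ∑' m, |f m| :=
    hf.sum_le_tsum _ fun _ _ => abs_nonneg _
  have h0 : 0 ≤ ∑ m ∈ cubePoints x₀ r, |f m| := Finset.sum_nonneg fun _ _ => abs_nonneg _
  refine le_trans ?_ h1
  refine mul_le_of_le_one_left h0 ?_
  rw [one_div]
  exact Nat.cast_inv_le_one _

/-- The total variation `∑_i ∑_n |g(n + e_i) - g(n)|`, with values in `[0, ∞]`. -/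
noncomputable def totalVariation {d : ℕ} (g : (Fin d → ℤ) → ℝ) : ℝ≥0∞ :=
  ∑ i : Fin d, ∑' n : Fin d → ℤ, ENNReal.ofReal |g (n + Pi.single i 1) - g n|

/-- `f` vanishes off a single point (its value there is arbitrary, possibly zero). -/
def IsDeltaFunction {d : ℕ} (f : (Fin d → ℤ) → ℝ) : Prop :=
  ∃ (p : Fin d → ℤ) (k : ℝ), f p = k ∧ ∀ n, n ≠ p → f n = 0

/-- The `k`-th term (`k ≥ 1`) of the series in the sharp constant. -/
noncomputable def sharpConstTerm (d : ℕ) (k : ℕ+) : ℝ :=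
  (1 / (k : ℝ)) * ((2 / ((k : ℝ) + 1) + (2 * (k : ℝ) - 1) / (k : ℝ)) ^ (d - 1)
    - ((2 * (k : ℝ) - 1) / (k : ℝ)) ^ (d - 1))

/-- The sharp constant in dimension `d ≥ 1`. -/
noncomputable def sharpConst (d : ℕ) : ℝ :=
  2 * (d : ℝ) * (1 + ∑' k : ℕ+, sharpConstTerm d k)

/-
On a line parallel to the `i`-th axis, each value of the maximal function is attained as the average
over a discrete cube meeting the line in an interval, on which the maximal function is at least as
large. A point `q` of that cube contributes at most its mass `|f q| / minCubeCard`, a quantity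
independent of the value in question. So every rise along the line is paid by masses of points
lying over the corresponding interval, no mass is used twice, and the variation along the line is
at most twice the sum of all these masses. For a fixed `q` the masses on all lines parallel to the
axis sum up, shell by shell in the sup norm, to `|f q|` times the series in the sharp constant.

If `f p` and `f q` are nonzero with `p i < q i`, the estimate on the line through `p` has slack:
removing a small mass `δ` from the charged mass at `p` when it is measured left of an interval, and
at `q` when it is measured beyond its right end, leaves a valid scheme with less total mass. For a
delta function each line carries a single peak of exactly the charged height, so equality holds.
-/

section Line

/-- The variation `∑_t |g(t + 1) - g(t)|` of a function on `ℤ`, with values in `[0, ∞]`. -/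
noncomputable def lineVariation (g : ℤ → ℝ) : ℝ≥0∞ :=
  ∑' t, ENNReal.ofReal |g (t + 1) - g t|

/-- A scheme paying for the rises of `g` with a mass distributed along `ℤ`: each value `g a` is at
most the mass of an interval around `a` on which `g ≥ g a`. The mass to the left of a point is
measured by `Λ` at left endpoints of such intervals and by `Ψ` beyond right endpoints. Taking
`Λ = Ψ` yields the sharp inequality; its strict form needs `Λ ≠ Ψ`. -/
structure IntervalCharging (g Λ Ψ : ℤ → ℝ) : Prop where
  left_nonneg : ∀ t, 0 ≤ Λ t
  left_mono : Monotone Λ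
  right_mono : Monotone Ψ
  right_le_left_add : ∀ t, Ψ t ≤ Λ t + g t
  exists_interval : ∀ a, ∃ l r, a ∈ Set.Icc l r ∧ (∀ t ∈ Set.Icc l r, g a ≤ g t) ∧
    Λ l + g a ≤ Ψ (r + 1)

namespace IntervalCharging

variable {g Λ Ψ : ℤ → ℝ} {A B : ℤ} {T : ℝ}

/- Half of the left-hand side is the sum of the rises of `g` on `[A, B]`, with `g A` counted as a
rise from `0`. When `g` falls after `B`, an interval charged by `g B` must end at `B`, so its mass
turns the bound `Λ l + g B` into `Ψ (B + 1)`. -/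
theorem sum_abs_sub_le_max (h : IntervalCharging g Λ Ψ) (hAB : A ≤ B) :
    ∀ l ≤ B, (∀ t ∈ Set.Icc l B, g B ≤ g t) →
      g A + ∑ t ∈ Finset.Ico A B, |g (t + 1) - g t| + g B ≤ 2 * max (Ψ B) (Λ l + g B) := by
  induction B, hAB using Int.leInduction with
  | base =>
    intro l _ _
    rw [Finset.Ico_self, Finset.sum_empty]
    linarith [h.left_nonneg l, le_max_right (Ψ A) (Λ l + g A)]
  | succ B hAB ih =>
    intro l hl hlB
    rw [← Finset.sum_Ico_add_eq_sum_Ico_add_one hAB]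
    have hΨ : Ψ B ≤ Ψ (B + 1) := h.right_mono (by omega)
    rcases lt_or_ge (g (B + 1)) (g B) with hdown | hup
    · obtain ⟨l', r, ⟨hl', hBr⟩, hlr, hmass⟩ := h.exists_interval B
      obtain rfl : r = B := hBr.antisymm' <| not_lt.mp fun hlt =>
        hdown.not_ge (hlr _ ⟨by omega, hlt⟩)
      rw [abs_of_neg (by linarith)]
      linarith [ih l' hl' hlr, max_le hΨ hmass, le_max_left (Ψ (r + 1)) (Λ l + g (r + 1))]
    rw [abs_of_nonneg (by linarith)]
    rcases hl.lt_or_eq with hlt | rfl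
    · have hflat : g (B + 1) = g B := le_antisymm (hlB B ⟨by omega, by omega⟩) hup
      have hih := ih l (by omega) fun t ht => hflat ▸ hlB t ⟨ht.1, by linarith [ht.2]⟩
      rw [hflat]
      linarith [max_le_max_right (Λ l + g B) hΨ]
    · have hih := ih B le_rfl fun t ht => (congrArg g (ht.2.antisymm ht.1)).ge
      rw [max_eq_right (h.right_le_left_add B)] at hih
      linarith [h.left_mono (show B ≤ B + 1 by omega),
        le_max_right (Ψ (B + 1)) (Λ (B + 1) + g (B + 1))]

theorem sum_abs_sub_le (h : IntervalCharging g Λ Ψ) (hg : ∀ t, 0 ≤ g t) (hT : ∀ t, Ψ t ≤ T)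
    (hAB : A ≤ B) : ∑ t ∈ Finset.Ico A B, |g (t + 1) - g t| ≤ 2 * T := by
  obtain ⟨l, r, ⟨hl, hr⟩, hlr, hmass⟩ := h.exists_interval B
  have hmax : max (Ψ B) (Λ l + g B) ≤ T := max_le (hT B) (hmass.trans (hT _))
  have := h.sum_abs_sub_le_max hAB l hl fun t ht => hlr t ⟨ht.1, ht.2.trans hr⟩
  linarith [hg A, hg B]

theorem lineVariation_le (h : IntervalCharging g Λ Ψ) (hg : ∀ t, 0 ≤ g t) (hT : ∀ t, Ψ t ≤ T) :
    lineVariation g ≤ ENNReal.ofReal (2 * T) := by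
  have hcover (s : Finset ℤ) : ∃ n : ℕ, s ⊆ Finset.Ico (-n : ℤ) n := by
    refine ⟨s.sup Int.natAbs + 1, fun t ht => Finset.mem_Ico.mpr ?_⟩
    have := Finset.le_sup (f := Int.natAbs) ht
    omega
  rw [lineVariation, ENNReal.tsum_eq_iSup_sum' _ hcover]
  refine iSup_le fun n => ?_
  rw [← ENNReal.ofReal_sum_of_nonneg fun _ _ => abs_nonneg _]
  exact ENNReal.ofReal_le_ofReal (h.sum_abs_sub_le hg hT (by omega))

end IntervalCharging

end Line

section DiscreteCubes

variable {d k : ℕ} {u v p q : Fin d → ℤ}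

/-- The box `Finset.Icc u v` is a discrete cube of size `k`: each of its sides has `k` or `k + 1`
points. These boxes, for varying `k`, are the sets of lattice points of closed cubes. -/
def IsDiscreteCube (k : ℕ) (u v : Fin d → ℤ) : Prop :=
  ∀ j, v j - u j = k ∨ v j + 1 - u j = k

theorem mem_cubePoints_iff_latticePoint_mem {x₀ : Fin d → ℝ} {r : ℝ} {m : Fin d → ℤ} :
    m ∈ cubePoints x₀ r ↔ latticePoint m ∈ Metric.closedBall x₀ r := by
  simp [cubePoints]

theorem mem_cubePoints {x₀ : Fin d → ℝ} {r : ℝ} (hr : 0 ≤ r) {m : Fin d → ℤ} :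
    m ∈ cubePoints x₀ r ↔ ∀ j, |(m j : ℝ) - x₀ j| ≤ r := by
  simp [mem_cubePoints_iff_latticePoint_mem, latticePoint, dist_pi_le_iff hr, Real.dist_eq]

theorem exists_isDiscreteCube_cubePoints_eq (x₀ : Fin d → ℝ) {r : ℝ} (hr : 0 ≤ r) :
    ∃ k u v, IsDiscreteCube k u v ∧ cubePoints x₀ r = Finset.Icc u v := by
  refine ⟨⌊2 * r⌋₊, fun j => ⌈x₀ j - r⌉, fun j => ⌊x₀ j + r⌋, fun j => ?_, ?_⟩
  · have hfloor : ((⌊2 * r⌋₊ : ℤ)) = ⌊2 * r⌋ := Int.natCast_floor_eq_floor (by positivity)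
    have hlower : ⌊2 * r⌋ < ⌊x₀ j + r⌋ - ⌈x₀ j - r⌉ + 2 := Int.floor_lt.mpr <| by
      push_cast
      linarith [Int.lt_floor_add_one (x₀ j + r), Int.ceil_lt_add_one (x₀ j - r)]
    have hupper : ⌊x₀ j + r⌋ - ⌈x₀ j - r⌉ ≤ ⌊2 * r⌋ := Int.le_floor.mpr <| by
      push_cast
      linarith [Int.floor_le (x₀ j + r), Int.le_ceil (x₀ j - r)]
    dsimp only
    omega
  · ext m
    rw [mem_cubePoints hr, Finset.mem_Icc, Pi.le_def, Pi.le_def, ← forall_and]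
    refine forall_congr' fun j => ?_
    rw [Int.ceil_le, Int.le_floor, abs_sub_le_iff]
    constructor <;> rintro ⟨h₁, h₂⟩ <;> constructor <;> linarith

theorem IsDiscreteCube.cubePoints_eq (h : IsDiscreteCube k u v) :
    cubePoints (fun j => ((u j + v j : ℤ) : ℝ) / 2) (k / 2) = Finset.Icc u v := by
  ext m
  rw [mem_cubePoints (by positivity), Finset.mem_Icc, Pi.le_def, Pi.le_def, ← forall_and]
  refine forall_congr' fun j => ?_
  have hscale : |(m j : ℝ) - ((u j + v j : ℤ) : ℝ) / 2| ≤ k / 2 ↔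
      |2 * m j - (u j + v j)| ≤ (k : ℤ) := by
    rw [← Int.cast_le (R := ℝ), abs_sub_le_iff, Int.cast_abs, abs_le]
    push_cast
    constructor <;> rintro ⟨h₁, h₂⟩ <;> constructor <;> linarith
  rw [hscale, abs_le]
  have := h j
  omega

/-- The sup norm of a lattice point, as a natural number. -/
def supNatAbs (w : Fin d → ℤ) : ℕ :=
  Finset.univ.sup fun j => (w j).natAbs

theorem natAbs_le_supNatAbs (w : Fin d → ℤ) (j : Fin d) : (w j).natAbs ≤ supNatAbs w :=
  Finset.le_sup (f := fun j => (w j).natAbs) (Finset.mem_univ j)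

/-- The number of points of a smallest discrete cube containing `0` and `w`, in a direction where
`w` has the coordinate `x`; here `k` is the sup norm of `w`. -/
def minCubeSide (k : ℕ) (x : ℤ) : ℕ :=
  if x.natAbs = k then k + 1 else k

/-- The number of points of a smallest discrete cube containing `0` and `w`. -/
def minCubeCard (w : Fin d → ℤ) : ℕ :=
  ∏ j, minCubeSide (supNatAbs w) (w j)

theorem natAbs_lt_minCubeSide (w : Fin d → ℤ) (j : Fin d) :
    (w j).natAbs < minCubeSide (supNatAbs w) (w j) := by
  have := natAbs_le_supNatAbs w j
  rw [minCubeSide]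
  split_ifs <;> omega

theorem minCubeCard_pos (w : Fin d → ℤ) : 0 < minCubeCard w :=
  Finset.prod_pos fun j _ => (Nat.zero_le _).trans_lt (natAbs_lt_minCubeSide w j)

theorem natAbs_sub_lt_card_side (hp : p ∈ Finset.Icc u v) (hq : q ∈ Finset.Icc u v) (j : Fin d) :
    ((q - p) j).natAbs < (Finset.Icc (u j) (v j)).card := by
  rw [Finset.mem_Icc, Pi.le_def, Pi.le_def] at hp hq
  have hpj := And.intro (hp.1 j) (hp.2 j)
  have hqj := And.intro (hq.1 j) (hq.2 j)
  rw [Int.card_Icc, Pi.sub_apply]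
  omega

theorem natAbs_sub_lt_card_Icc (hp : p ∈ Finset.Icc u v) (hq : q ∈ Finset.Icc u v) (j : Fin d) :
    ((q - p) j).natAbs < (Finset.Icc u v).card := by
  refine (natAbs_sub_lt_card_side hp hq j).trans_le ?_
  rw [Pi.card_Icc]
  exact Finset.single_le_prod' (f := fun i => (Finset.Icc (u i) (v i)).card)
    (fun i _ => (Nat.zero_le _).trans_lt (natAbs_sub_lt_card_side hp hq i)) (Finset.mem_univ j)

theorem IsDiscreteCube.minCubeCard_le (h : IsDiscreteCube k u v) (hp : p ∈ Finset.Icc u v)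
    (hq : q ∈ Finset.Icc u v) : minCubeCard (q - p) ≤ (Finset.Icc u v).card := by
  have hside := natAbs_sub_lt_card_side hp hq
  simp only [Int.card_Icc] at hside
  have hk : supNatAbs (q - p) ≤ k := Finset.sup_le fun j _ => by
    have := hside j
    have := h j
    omega
  rw [Pi.card_Icc]
  refine Finset.prod_le_prod' fun j _ => ?_
  have := hside j
  have := h j
  rw [Int.card_Icc, minCubeSide]
  split_ifs <;> omega

theorem exists_isDiscreteCube_card_eq_minCubeCard (p q : Fin d → ℤ) :
    ∃ k u v, IsDiscreteCube k u v ∧ p ∈ Finset.Icc u v ∧ q ∈ Finset.Icc u v ∧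
      (Finset.Icc u v).card = minCubeCard (q - p) := by
  refine ⟨supNatAbs (q - p), p ⊓ q,
    fun j => (p ⊓ q) j + minCubeSide (supNatAbs (q - p)) ((q - p) j) - 1,
    fun j => ?_, ?_, ?_, ?_⟩
  · dsimp only [minCubeSide]
    split_ifs <;> omega
  · refine Finset.mem_Icc.mpr ⟨inf_le_left, fun j => ?_⟩
    have := natAbs_lt_minCubeSide (q - p) j
    simp only [Pi.inf_apply, Pi.sub_apply] at this ⊢
    omega
  · refine Finset.mem_Icc.mpr ⟨inf_le_right, fun j => ?_⟩
    have := natAbs_lt_minCubeSide (q - p) j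
    simp only [Pi.inf_apply, Pi.sub_apply] at this ⊢
    omega
  · rw [Pi.card_Icc]
    refine Finset.prod_congr rfl fun j _ => ?_
    rw [Int.card_Icc]
    omega

end DiscreteCubes

section MaximalFunction

theorem csSup_mem_of_finite_inter_Ioi {α : Type*} [ConditionallyCompleteLinearOrder α] {S : Set α}
    {c : α} (hne : S.Nonempty) (hc : c < sSup S) (hfin : (S ∩ Set.Ioi c).Finite) : sSup S ∈ S := by
  obtain ⟨a, haS, hca⟩ := exists_lt_of_lt_csSup hne hc
  obtain ⟨b, ⟨hbS, hcb⟩, hmax⟩ := Set.exists_max_image _ id hfin ⟨a, haS, hca⟩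
  have hgreatest : IsGreatest S b :=
    ⟨hbS, fun x hx => (le_or_gt x c).elim (fun hxc => hxc.trans hcb.le) fun hcx => hmax x ⟨hx, hcx⟩⟩
  exact hgreatest.csSup_mem

variable {d : ℕ} {f : (Fin d → ℤ) → ℝ} {n : Fin d → ℤ}

theorem uncenteredMaximal_nonneg (f : (Fin d → ℤ) → ℝ) (n : Fin d → ℤ) :
    0 ≤ uncenteredMaximal f n := by
  refine Real.sSup_nonneg ?_
  rintro _ ⟨x₀, r, -, -, rfl⟩
  exact mul_nonneg (by positivity) (Finset.sum_nonneg fun _ _ => abs_nonneg _)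

theorem mem_cubeAverages_iff {a : ℝ} :
    a ∈ cubeAverages f n ↔ ∃ k u v, IsDiscreteCube k u v ∧ n ∈ Finset.Icc u v ∧
      a = (∑ m ∈ Finset.Icc u v, |f m|) / (Finset.Icc u v).card := by
  simp only [cubeAverages, cubeAverage, Set.mem_ofPred_eq, one_div_mul_eq_div,
    ← mem_cubePoints_iff_latticePoint_mem]
  constructor
  · rintro ⟨x₀, r, hr, hn, rfl⟩
    obtain ⟨k, u, v, h, heq⟩ := exists_isDiscreteCube_cubePoints_eq x₀ hr
    exact ⟨k, u, v, h, heq ▸ hn, by rw [heq]⟩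
  · rintro ⟨k, u, v, h, hn, rfl⟩
    exact ⟨_, _, by positivity, h.cubePoints_eq ▸ hn, by rw [h.cubePoints_eq]⟩

theorem IsDiscreteCube.sum_div_card_le_uncenteredMaximal {k : ℕ} {u v : Fin d → ℤ}
    (h : IsDiscreteCube k u v) (hf : Summable fun m => |f m|) (hn : n ∈ Finset.Icc u v) :
    (∑ m ∈ Finset.Icc u v, |f m|) / (Finset.Icc u v).card ≤ uncenteredMaximal f n :=
  le_csSup (bddAbove_cubeAverages f hf n) (mem_cubeAverages_iff.mpr ⟨k, u, v, h, hn, rfl⟩)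

theorem finite_cubeAverages_inter_Ioi (hf : Summable fun m => |f m|) (n : Fin d → ℤ) {c : ℝ}
    (hc : 0 < c) : (cubeAverages f n ∩ Set.Ioi c).Finite := by
  obtain ⟨N, hN⟩ := exists_nat_gt ((∑' m, |f m|) / c)
  let boxes := Set.Icc (n - fun _ => (N : ℤ)) n ×ˢ Set.Icc n (n + fun _ => (N : ℤ))
  have hboxes : boxes.Finite := (Set.finite_Icc _ _).prod (Set.finite_Icc _ _)
  refine (hboxes.image fun b =>
    (∑ m ∈ Finset.Icc b.1 b.2, |f m|) / (Finset.Icc b.1 b.2).card).subset ?_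
  rintro _ ⟨ha, hlt⟩
  obtain ⟨k, u, v, -, hn, rfl⟩ := mem_cubeAverages_iff.mp ha
  have hcard : 0 < ((Finset.Icc u v).card : ℝ) := by exact_mod_cast Finset.card_pos.mpr ⟨n, hn⟩
  have hcardN : (Finset.Icc u v).card < N := by
    rw [Set.mem_Ioi, lt_div_iff₀ hcard] at hlt
    rw [div_lt_iff₀ hc] at hN
    have hsum : ∑ m ∈ Finset.Icc u v, |f m| ≤ ∑' m, |f m| :=
      hf.sum_le_tsum _ fun _ _ => abs_nonneg _
    have : (Finset.Icc u v).card * c < N * c := by linarith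
    exact_mod_cast lt_of_mul_lt_mul_right this hc.le
  have huv := Finset.mem_Icc.mp hn
  have hle : u ≤ v := huv.1.trans huv.2
  refine ⟨(u, v), ⟨⟨fun j => ?_, huv.1⟩, huv.2, fun j => ?_⟩, rfl⟩
  · have := natAbs_sub_lt_card_Icc (Finset.left_mem_Icc.mpr hle) hn j
    simp only [Pi.sub_apply] at this ⊢
    omega
  · have := natAbs_sub_lt_card_Icc hn (Finset.right_mem_Icc.mpr hle) j
    simp only [Pi.sub_apply, Pi.add_apply] at this ⊢
    omega

theorem abs_le_uncenteredMaximal (hf : Summable fun m => |f m|) (n : Fin d → ℤ) :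
    |f n| ≤ uncenteredMaximal f n :=
  le_csSup (bddAbove_cubeAverages f hf n) <| mem_cubeAverages_iff.mpr
    ⟨0, n, n, fun _ => .inl (by simp), by simp, by simp⟩

theorem uncenteredMaximal_mem_cubeAverages (hf : Summable fun m => |f m|) (n : Fin d → ℤ) :
    uncenteredMaximal f n ∈ cubeAverages f n := by
  rcases (uncenteredMaximal_nonneg f n).eq_or_lt with hzero | hpos
  · have hn : |f n| = 0 :=
      le_antisymm (hzero ▸ abs_le_uncenteredMaximal hf n) (abs_nonneg _)
    exact mem_cubeAverages_iff.mpr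
      ⟨0, n, n, fun _ => .inl (by simp), by simp, by simp [← hzero, hn]⟩
  · exact csSup_mem_of_finite_inter_Ioi (cubeAverages_nonempty f n) (half_lt_self hpos)
      (finite_cubeAverages_inter_Ioi hf n (half_pos hpos))

theorem div_minCubeCard_le_uncenteredMaximal (hf : Summable fun m => |f m|) (p n : Fin d → ℤ) :
    |f p| / minCubeCard (n - p) ≤ uncenteredMaximal f n := by
  obtain ⟨k, u, v, h, hp, hn, hcard⟩ := exists_isDiscreteCube_card_eq_minCubeCard p n
  refine le_trans ?_ (h.sum_div_card_le_uncenteredMaximal hf hn)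
  rw [hcard]
  gcongr
  exact Finset.single_le_sum (f := fun m => |f m|) (fun _ _ => abs_nonneg _) hp

theorem uncenteredMaximal_pos (hf : Summable fun m => |f m|) {p : Fin d → ℤ} (hp : f p ≠ 0)
    (n : Fin d → ℤ) : 0 < uncenteredMaximal f n :=
  (div_pos (abs_pos.mpr hp) (Nat.cast_pos.mpr (minCubeCard_pos _))).trans_le
    (div_minCubeCard_le_uncenteredMaximal hf p n)

end MaximalFunction

section SharpConstant

variable {e k : ℕ} {m : Fin e → ℤ}

theorem supNatAbs_le_iff : supNatAbs m ≤ k ↔ m ∈ Finset.Icc (-(k : Fin e → ℤ)) k := by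
  simp only [supNatAbs, Finset.sup_le_iff, Finset.mem_univ, forall_true_left, Finset.mem_Icc,
    Pi.le_def, ← forall_and, Pi.neg_apply, Pi.natCast_apply]
  exact forall_congr' fun j => by omega

theorem mem_box_iff_supNatAbs_eq : m ∈ Finset.box k ↔ supNatAbs m = k := by
  cases k with
  | zero =>
    rw [Finset.box_zero, Finset.mem_singleton, ← Nat.le_zero, supNatAbs_le_iff]
    simp
  | succ k =>
    rw [Finset.box_succ_eq_sdiff, Finset.mem_sdiff, ← supNatAbs_le_iff, ← supNatAbs_le_iff]
    omega

/-- The reciprocal of the number of points of a smallest discrete cube containing `0` and a point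
of the axis-parallel line whose transversal coordinates are `m`. The factor `max (supNatAbs m) 1` is
its side in the direction of the line. -/
noncomputable def lineWeight (m : Fin e → ℤ) : ℝ :=
  (max (supNatAbs m) 1 * minCubeCard m : ℝ)⁻¹

theorem lineWeight_pos (m : Fin e → ℤ) : 0 < lineWeight m := by
  have := minCubeCard_pos m
  rw [lineWeight]
  positivity

theorem lineWeight_le_one (m : Fin e → ℤ) : lineWeight m ≤ 1 := by
  rw [lineWeight]
  exact inv_le_one_of_one_le₀ (by exact_mod_cast Nat.mul_pos (by simp) (minCubeCard_pos m))

theorem lineWeight_zero : lineWeight (0 : Fin e → ℤ) = 1 := by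
  have hnorm : supNatAbs (0 : Fin e → ℤ) = 0 := mem_box_iff_supNatAbs_eq.mp (by simp)
  simp [lineWeight, minCubeCard, minCubeSide, hnorm]

theorem supNatAbs_insertNth_zero (i : Fin (e + 1)) (m : Fin e → ℤ) :
    supNatAbs (i.insertNth 0 m : Fin (e + 1) → ℤ) = supNatAbs m := by
  refine eq_of_forall_ge_iff fun k => ?_
  simp [supNatAbs, Fin.forall_iff_succAbove i]

theorem inv_minCubeCard_insertNth_zero (i : Fin (e + 1)) (m : Fin e → ℤ) :
    (minCubeCard (i.insertNth 0 m : Fin (e + 1) → ℤ) : ℝ)⁻¹ = lineWeight m := by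
  have hside : minCubeSide (supNatAbs m) 0 = max (supNatAbs m) 1 := by
    rw [minCubeSide, Int.natAbs_zero]
    split_ifs <;> omega
  rw [lineWeight, minCubeCard, Fin.prod_univ_succAbove _ i, supNatAbs_insertNth_zero]
  simp [hside, minCubeCard]

theorem sum_Icc_inv_minCubeSide (k : ℕ) :
    ∑ x ∈ Finset.Icc (-(k : ℤ)) k, (minCubeSide (k + 1) x : ℝ)⁻¹ = (2 * (k + 1) - 1) / (k + 1) := by
  have hconst : ∀ x ∈ Finset.Icc (-(k : ℤ)) k,
      (minCubeSide (k + 1) x : ℝ)⁻¹ = ((k : ℝ) + 1)⁻¹ := fun x hx => by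
    rw [Finset.mem_Icc] at hx
    rw [minCubeSide, if_neg (by omega), Nat.cast_add_one]
  rw [Finset.sum_congr rfl hconst, Finset.sum_const, Int.card_Icc, nsmul_eq_mul, div_eq_mul_inv,
    show ((k : ℤ) + 1 - -k).toNat = 2 * k + 1 by omega]
  push_cast
  ring

theorem sum_Icc_succ_inv_minCubeSide (k : ℕ) :
    ∑ x ∈ Finset.Icc (-((k + 1 : ℕ) : ℤ)) (k + 1 : ℕ), (minCubeSide (k + 1) x : ℝ)⁻¹ =
      2 / (k + 1 + 1) + (2 * (k + 1) - 1) / (k + 1) := by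
  have hIcc : Finset.Icc (-((k + 1 : ℕ) : ℤ)) (k + 1 : ℕ) =
      insert ((k : ℤ) + 1) (insert (-((k : ℤ) + 1)) (Finset.Icc (-(k : ℤ)) k)) := by
    ext x
    simp only [Finset.mem_insert, Finset.mem_Icc]
    omega
  have hend {x : ℤ} (hx : x.natAbs = k + 1) :
      (minCubeSide (k + 1) x : ℝ)⁻¹ = ((k : ℝ) + 1 + 1)⁻¹ := by
    rw [minCubeSide, if_pos hx, Nat.cast_add_one, Nat.cast_add_one]
  rw [hIcc, Finset.sum_insert (by simp only [Finset.mem_insert, Finset.mem_Icc]; omega),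
    Finset.sum_insert (by simp), sum_Icc_inv_minCubeSide, hend (by omega), hend (by omega)]
  ring

theorem sum_box_lineWeight (e k : ℕ) :
    ∑ m ∈ Finset.box (α := Fin e → ℤ) (k + 1), lineWeight m =
      sharpConstTerm (e + 1) k.succPNat := by
  have hprod : ∀ m ∈ Finset.box (α := Fin e → ℤ) (k + 1),
      lineWeight m = ((k : ℝ) + 1)⁻¹ * ∏ j, (minCubeSide (k + 1) (m j) : ℝ)⁻¹ := fun m hm => by
    rw [lineWeight, minCubeCard, mem_box_iff_supNatAbs_eq.mp hm, mul_inv, Nat.cast_prod,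
      Finset.prod_inv_distrib]
    simp
  have hcube (l : ℕ) : ∑ m ∈ Finset.Icc (-(l : Fin e → ℤ)) l,
      ∏ j, (minCubeSide (k + 1) (m j) : ℝ)⁻¹ =
        (∑ x ∈ Finset.Icc (-(l : ℤ)) l, (minCubeSide (k + 1) x : ℝ)⁻¹) ^ e :=
    (Finset.prod_univ_sum (fun _ : Fin e => Finset.Icc (-(l : ℤ)) l)
      fun _ x => (minCubeSide (k + 1) x : ℝ)⁻¹).symm.trans (by simp)
  have hsubset : Finset.Icc (-(k : Fin e → ℤ)) k ⊆ Finset.Icc (-(k.succ : Fin e → ℤ)) k.succ :=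
    fun m hm => supNatAbs_le_iff.mp ((supNatAbs_le_iff.mpr hm).trans k.le_succ)
  rw [Finset.sum_congr rfl hprod, ← Finset.mul_sum, Finset.box_succ_eq_sdiff,
    Finset.sum_sdiff_eq_sub hsubset, hcube, hcube, sum_Icc_inv_minCubeSide,
    sum_Icc_succ_inv_minCubeSide, sharpConstTerm]
  simp

theorem sharpConstTerm_nonneg (d : ℕ) (k : ℕ+) : 0 ≤ sharpConstTerm d k := by
  have hk : (1 : ℝ) ≤ k := by exact_mod_cast k.pos
  have hbase : 0 ≤ (2 * (k : ℝ) - 1) / k := div_nonneg (by linarith) (by linarith)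
  have hstep : 0 ≤ 2 / ((k : ℝ) + 1) := by positivity
  refine mul_nonneg (by positivity) (sub_nonneg.mpr ?_)
  gcongr
  linarith

theorem add_pow_sub_pow_le {a b c : ℝ} (ha : 0 ≤ a) (hb : 0 ≤ b) (hc : a + b ≤ c) (n : ℕ) :
    (a + b) ^ n - b ^ n ≤ a * n * c ^ (n - 1) := by
  have h := (le_abs_self _).trans (abs_pow_sub_pow_le (a + b) b n)
  rw [add_sub_cancel_right, abs_of_nonneg ha, abs_of_nonneg hb, abs_of_nonneg (add_nonneg ha hb),
    max_eq_left (le_add_of_nonneg_left ha)] at h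
  exact h.trans (by gcongr)

theorem sharpConstTerm_le (d : ℕ) (k : ℕ+) :
    sharpConstTerm d k ≤ 2 * (d - 1 : ℕ) * 3 ^ (d - 1 - 1) * (1 / (k : ℝ) ^ 2) := by
  have hk : (1 : ℝ) ≤ k := by exact_mod_cast k.pos
  have hk0 : (0 : ℝ) < k := by linarith
  have hbase : 0 ≤ (2 * (k : ℝ) - 1) / k := div_nonneg (by linarith) hk0.le
  have hbase_le : (2 * (k : ℝ) - 1) / k ≤ 2 := by rw [div_le_iff₀ hk0]; linarith
  have hstep_le : 2 / ((k : ℝ) + 1) ≤ 1 := by rw [div_le_one (by linarith)]; linarith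
  calc sharpConstTerm d k
      ≤ 1 / k * (2 / ((k : ℝ) + 1) * (d - 1 : ℕ) * 3 ^ (d - 1 - 1)) :=
        mul_le_mul_of_nonneg_left
          (add_pow_sub_pow_le (by positivity) hbase (by linarith) _) (by positivity)
    _ ≤ 1 / k * (2 / k * (d - 1 : ℕ) * 3 ^ (d - 1 - 1)) := by
        gcongr
        linarith
    _ = 2 * (d - 1 : ℕ) * 3 ^ (d - 1 - 1) * (1 / (k : ℝ) ^ 2) := by ring

theorem summable_sharpConstTerm (d : ℕ) : Summable (sharpConstTerm d) :=
  .of_nonneg_of_le (sharpConstTerm_nonneg d) (sharpConstTerm_le d) <| .mul_left _ <|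
    (Real.summable_one_div_nat_pow.mpr one_lt_two).comp_injective PNat.coe_injective

theorem tsum_lineWeight (e : ℕ) :
    ∑' m : Fin e → ℤ, ENNReal.ofReal (lineWeight m) =
      ENNReal.ofReal (1 + ∑' k, sharpConstTerm (e + 1) k) := by
  have hshell (k : ℕ) : supNatAbs (d := e) ⁻¹' {k} = ↑(Finset.box (α := Fin e → ℤ) k) :=
    Set.ext fun m => mem_box_iff_supNatAbs_eq.symm
  have hsum (k : ℕ) : ∑' m : supNatAbs (d := e) ⁻¹' {k}, ENNReal.ofReal (lineWeight m.1) =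
      ENNReal.ofReal (∑ m ∈ Finset.box (α := Fin e → ℤ) k, lineWeight m) := by
    rw [hshell, Finset.tsum_subtype' _ fun m => ENNReal.ofReal (lineWeight m),
      ENNReal.ofReal_sum_of_nonneg fun m _ => (lineWeight_pos m).le]
  rw [← ENNReal.tsum_fiberwise _ (supNatAbs (d := e)), tsum_eq_zero_add' ENNReal.summable,
    ENNReal.ofReal_add zero_le_one (tsum_nonneg (sharpConstTerm_nonneg _)),
    ENNReal.ofReal_tsum_of_nonneg (sharpConstTerm_nonneg _) (summable_sharpConstTerm _),
    ← Equiv.pnatEquivNat.symm.tsum_eq]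
  simp only [hsum, Finset.box_zero, Finset.sum_singleton, lineWeight_zero, sum_box_lineWeight]
  rfl

theorem sharpConst_pos {d : ℕ} (hd : 1 ≤ d) : 0 < sharpConst d := by
  have : 0 ≤ ∑' k, sharpConstTerm d k := tsum_nonneg (sharpConstTerm_nonneg d)
  rw [sharpConst]
  positivity

theorem sharpConst_one : sharpConst 1 = 2 := by
  simp [sharpConst, sharpConstTerm]

theorem tsum_sharpConstTerm_two : ∑' k, sharpConstTerm 2 k = 2 := by
  have htelescope (k : ℕ) : sharpConstTerm 2 k.succPNat = 2 * (1 / ((k : ℝ) + 1)) -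
      2 * (1 / (((k + 1 : ℕ) : ℝ) + 1)) := by
    simp only [sharpConstTerm, Nat.succPNat_coe, Nat.succ_eq_add_one, Nat.cast_add, Nat.cast_one,
      Nat.add_one_sub_one, pow_one, add_sub_cancel_right]
    field_simp
    ring
  have hlim : Filter.Tendsto (fun n : ℕ => 2 - 2 * (1 / ((n : ℝ) + 1))) Filter.atTop (nhds 2) := by
    simpa using (tendsto_one_div_add_atTop_nhds_zero_nat (𝕜 := ℝ)).const_mul 2 |>.const_sub 2
  rw [← Equiv.pnatEquivNat.symm.tsum_eq]
  refine HasSum.tsum_eq ((hasSum_iff_tendsto_nat_of_nonneg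
    (fun _ => sharpConstTerm_nonneg 2 _) _).mpr (hlim.congr fun n => ?_))
  calc 2 - 2 * (1 / ((n : ℝ) + 1)) = ∑ k ∈ Finset.range n, sharpConstTerm 2 k.succPNat := by
        simp_rw [htelescope]
        rw [Finset.sum_range_sub' fun k : ℕ => 2 * (1 / ((k : ℝ) + 1))]
        simp
    _ = _ := rfl

theorem sharpConst_two : sharpConst 2 = 12 := by
  rw [sharpConst, tsum_sharpConstTerm_two]
  norm_num

end SharpConstant

section LeftMass

variable {d : ℕ} {F : (Fin d → ℤ) → ℝ} {i : Fin d} {p q : Fin d → ℤ} {δ : ℝ}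

/-- The mass of `F` on the open half-space `{q | q i < s}`. -/
noncomputable def leftMass (F : (Fin d → ℤ) → ℝ) (i : Fin d) (s : ℤ) : ℝ :=
  ∑' q, {q | q i < s}.indicator F q

theorem leftMass_nonneg (hF : 0 ≤ F) (i : Fin d) (s : ℤ) : 0 ≤ leftMass F i s :=
  tsum_nonneg fun _ => Set.indicator_nonneg (fun q _ => hF q) _

theorem leftMass_le_tsum (hF : 0 ≤ F) (hs : Summable F) (i : Fin d) (s : ℤ) :
    leftMass F i s ≤ ∑' q, F q :=
  (hs.indicator _).tsum_le_tsum (fun q => Set.indicator_le_self' (fun q _ => hF q) q) hs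

theorem leftMass_add_sum_le (hF : 0 ≤ F) (hs : Summable F) {l r : ℤ} {Q : Finset (Fin d → ℤ)}
    (hlr : l ≤ r) (hQ : ∀ q ∈ Q, q i ∈ Set.Ico l r) :
    leftMass F i l + ∑ q ∈ Q, F q ≤ leftMass F i r := by
  have hdisj : Disjoint {q : Fin d → ℤ | q i < l} Q :=
    Set.disjoint_left.mpr fun q hql hqQ => (hQ q hqQ).1.not_gt hql
  have hsub : {q : Fin d → ℤ | q i < l} ∪ Q ⊆ {q | q i < r} :=
    Set.union_subset (fun q hq => lt_of_lt_of_le hq hlr) fun q hq => (hQ q hq).2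
  calc leftMass F i l + ∑ q ∈ Q, F q = ∑' q, ({q | q i < l} ∪ ↑Q : Set _).indicator F q := by
        rw [Set.indicator_union_of_disjoint hdisj, sum_eq_tsum_indicator]
        exact ((hs.indicator _).tsum_add (hs.indicator _)).symm
    _ ≤ leftMass F i r := (hs.indicator _).tsum_le_tsum
        (Set.indicator_le_indicator_of_subset hsub hF) (hs.indicator _)

theorem leftMass_mono (hF : 0 ≤ F) (hs : Summable F) (i : Fin d) : Monotone (leftMass F i) :=
  fun _ _ hlr => by simpa using leftMass_add_sum_le (Q := ∅) hF hs hlr (by simp)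

theorem sub_single_nonneg (hF : 0 ≤ F) (hp : δ ≤ F p) : 0 ≤ F - Pi.single p δ :=
  sub_nonneg.mpr (update_le_iff.mpr ⟨hp, fun q _ => hF q⟩)

theorem summable_sub_single (hs : Summable F) (p : Fin d → ℤ) (δ : ℝ) :
    Summable (F - Pi.single p δ) :=
  hs.sub (hasSum_pi_single p δ).summable

theorem tsum_sub_single (hs : Summable F) (p : Fin d → ℤ) (δ : ℝ) :
    ∑' q, (F - Pi.single p δ : (Fin d → ℤ) → ℝ) q = ∑' q, F q - δ :=
  (hs.tsum_sub (hasSum_pi_single p δ).summable).trans (by rw [tsum_pi_single])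

theorem leftMass_sub_single (hs : Summable F) (p : Fin d → ℤ) (δ : ℝ) (i : Fin d) (s : ℤ) :
    leftMass (F - Pi.single p δ) i s = leftMass F i s - if p i < s then δ else 0 := by
  have hsingle : Summable (Pi.single p δ : (Fin d → ℤ) → ℝ) := (hasSum_pi_single p δ).summable
  have hmass : ∑' q, {q | q i < s}.indicator (Pi.single p δ) q = if p i < s then δ else 0 := by
    rw [tsum_eq_single p fun q hq => by simp [Set.indicator_apply, hq]]
    simp [Set.indicator_apply]
  rw [leftMass, Set.indicator_sub', ← hmass]
  exact (hs.indicator _).tsum_sub (hsingle.indicator _)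

/- Moving mass `δ` from `p` to the right is what makes the charging inequality strict: an interval
reaching from `p i` to `q i` has to afford the extra amount `δ`. -/
theorem intervalCharging_leftMass_sub_single {g : ℤ → ℝ} (hF : 0 ≤ F) (hs : Summable F)
    (hg : ∀ t, 0 ≤ g t) (hδ : 0 ≤ δ) (hp : δ ≤ F p) (hq : δ ≤ F q)
    (hpq : ∀ t ∈ Set.Ioc (p i) (q i), δ ≤ g t)
    (hI : ∀ a, ∃ (l r : ℤ) (Q : Finset (Fin d → ℤ)), a ∈ Set.Icc l r ∧
      (∀ t ∈ Set.Icc l r, g a ≤ g t) ∧ (∀ z ∈ Q, z i ∈ Set.Icc l r) ∧ g a ≤ ∑ z ∈ Q, F z ∧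
      (l ≤ p i → q i ≤ r → g a + δ ≤ ∑ z ∈ Q, F z)) :
    IntervalCharging g (leftMass (F - Pi.single p δ) i) (leftMass (F - Pi.single q δ) i) := by
  refine ⟨leftMass_nonneg (sub_single_nonneg hF hp) i,
    leftMass_mono (sub_single_nonneg hF hp) (summable_sub_single hs p δ) i,
    leftMass_mono (sub_single_nonneg hF hq) (summable_sub_single hs q δ) i,
    fun t => ?_, fun a => ?_⟩
  · rw [leftMass_sub_single hs, leftMass_sub_single hs]
    by_cases ht : t ∈ Set.Ioc (p i) (q i)
    · rw [if_pos ht.1, if_neg ht.2.not_gt]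
      linarith [hpq t ht]
    · have := hg t
      simp only [Set.mem_Ioc, not_and, not_le] at ht
      split_ifs <;> first | linarith | exact absurd (ht ‹_›) ‹_›
  · obtain ⟨l, r, Q, ha, hmin, hQ, hmass, hslack⟩ := hI a
    refine ⟨l, r, ha, hmin, ?_⟩
    have hleft := leftMass_add_sum_le (r := r + 1) hF hs (by linarith [ha.1, ha.2])
      fun z hz => ⟨(hQ z hz).1, Int.lt_add_one_iff.mpr (hQ z hz).2⟩
    rw [leftMass_sub_single hs, leftMass_sub_single hs]
    by_cases hlr : l ≤ p i ∧ q i ≤ r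
    · rw [if_neg hlr.1.not_gt, if_pos (Int.lt_add_one_iff.mpr hlr.2)]
      linarith [hslack hlr.1 hlr.2]
    · split_ifs <;> first | linarith | exact absurd ⟨by omega, by omega⟩ hlr

theorem IntervalCharging.lineVariation_le_two_mul_tsum_sub {g Λ : ℤ → ℝ}
    (h : IntervalCharging g Λ (leftMass (F - Pi.single q δ) i)) (hF : 0 ≤ F) (hs : Summable F)
    (hg : ∀ t, 0 ≤ g t) (hq : δ ≤ F q) :
    lineVariation g ≤ ENNReal.ofReal (2 * (∑' z, F z - δ)) :=
  h.lineVariation_le hg fun t =>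
    (leftMass_le_tsum (sub_single_nonneg hF hq) (summable_sub_single hs q δ) i t).trans_eq
      (tsum_sub_single hs q δ)

end LeftMass

section AxisParallelLines

variable {e : ℕ} {f : (Fin (e + 1) → ℤ) → ℝ}

theorem totalVariation_eq_sum_lineVariation (g : (Fin (e + 1) → ℤ) → ℝ) :
    totalVariation g =
      ∑ i : Fin (e + 1), ∑' m : Fin e → ℤ, lineVariation fun t => g (i.insertNth t m) := by
  refine Finset.sum_congr rfl fun i _ => ?_
  rw [← (Fin.insertNthEquiv (fun _ => ℤ) i).tsum_eq, ENNReal.tsum_prod', ENNReal.tsum_comm]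
  refine tsum_congr fun m => tsum_congr fun t => ?_
  have hshift : (i.insertNth t m : Fin (e + 1) → ℤ) + Pi.single i 1 = i.insertNth (t + 1) m := by
    ext j
    rcases i.eq_self_or_eq_succAbove j with rfl | ⟨j, rfl⟩ <;> simp
  beta_reduce
  rw [← hshift]
  rfl

/-- The mass by which the lattice point `q` pays for the variation of the maximal function on the
line `{i.insertNth t m | t}`: the share of `|f q|` in an average over a smallest discrete cube that
contains `q` and meets the line. -/
noncomputable def lineMass (f : (Fin (e + 1) → ℤ) → ℝ) (i : Fin (e + 1)) (m : Fin e → ℤ)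
    (q : Fin (e + 1) → ℤ) : ℝ :=
  |f q| * lineWeight (m - i.removeNth q)

theorem lineMass_nonneg (f : (Fin (e + 1) → ℤ) → ℝ) (i : Fin (e + 1)) (m : Fin e → ℤ) :
    0 ≤ lineMass f i m :=
  fun _ => mul_nonneg (abs_nonneg _) (lineWeight_pos _).le

theorem summable_lineMass (hf : Summable fun q => |f q|) (i : Fin (e + 1)) (m : Fin e → ℤ) :
    Summable (lineMass f i m) :=
  hf.of_nonneg_of_le (lineMass_nonneg f i m) fun _ =>
    mul_le_of_le_one_right (abs_nonneg _) (lineWeight_le_one _)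

theorem lineMass_removeNth_self (f : (Fin (e + 1) → ℤ) → ℝ) (i : Fin (e + 1))
    (p : Fin (e + 1) → ℤ) : lineMass f i (i.removeNth p) p = |f p| := by
  rw [lineMass, sub_self, lineWeight_zero, mul_one]

theorem lineMass_eq_div_minCubeCard (f : (Fin (e + 1) → ℤ) → ℝ) (i : Fin (e + 1)) (m : Fin e → ℤ)
    (q : Fin (e + 1) → ℤ) :
    lineMass f i m q = |f q| / minCubeCard (i.insertNth (q i) m - q) := by
  have hdiff : (i.insertNth (q i) m - q : Fin (e + 1) → ℤ) =
      i.insertNth 0 (m - i.removeNth q) := by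
    ext j
    rcases i.eq_self_or_eq_succAbove j with rfl | ⟨j, rfl⟩ <;> simp [Fin.removeNth]
  rw [lineMass, hdiff, div_eq_mul_inv, inv_minCubeCard_insertNth_zero]

theorem apply_mem_Icc_of_mem_Icc {d : ℕ} {u v q : Fin d → ℤ} (hq : q ∈ Finset.Icc u v)
    (i : Fin d) : q i ∈ Set.Icc (u i) (v i) :=
  ⟨(Finset.mem_Icc.mp hq).1 i, (Finset.mem_Icc.mp hq).2 i⟩

theorem exists_maximizing_box_of_line (hf : Summable fun q => |f q|) (i : Fin (e + 1))
    (m : Fin e → ℤ) (a : ℤ) :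
    ∃ u v : Fin (e + 1) → ℤ, a ∈ Set.Icc (u i) (v i) ∧
      (∀ t ∈ Set.Icc (u i) (v i), i.insertNth t m ∈ Finset.Icc u v ∧
        uncenteredMaximal f (i.insertNth a m) ≤ uncenteredMaximal f (i.insertNth t m)) ∧
      uncenteredMaximal f (i.insertNth a m) =
        ∑ q ∈ Finset.Icc u v, |f q| / (Finset.Icc u v).card ∧
      ∀ q ∈ Finset.Icc u v, |f q| / (Finset.Icc u v).card ≤ lineMass f i m q := by
  obtain ⟨k, u, v, h, ha, hmax⟩ :=
    mem_cubeAverages_iff.mp (uncenteredMaximal_mem_cubeAverages hf (i.insertNth a m))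
  rw [← Finset.mem_coe, Finset.coe_Icc, Fin.insertNth_mem_Icc] at ha
  have hline {t : ℤ} (ht : t ∈ Set.Icc (u i) (v i)) : i.insertNth t m ∈ Finset.Icc u v := by
    rw [← Finset.mem_coe, Finset.coe_Icc, Fin.insertNth_mem_Icc]
    exact ⟨ht, ha.2⟩
  refine ⟨u, v, ha.1, fun t ht => ⟨hline ht, ?_⟩, hmax.trans (Finset.sum_div _ _ _), fun q hq => ?_⟩
  · exact hmax.trans_le (h.sum_div_card_le_uncenteredMaximal hf (hline ht))
  · have hq_line := hline (apply_mem_Icc_of_mem_Icc hq i)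
    rw [lineMass_eq_div_minCubeCard]
    gcongr
    · exact_mod_cast minCubeCard_pos _
    · exact h.minCubeCard_le hq hq_line

theorem lineVariation_uncenteredMaximal_le (hf : Summable fun q => |f q|) (i : Fin (e + 1))
    (m : Fin e → ℤ) :
    lineVariation (fun t => uncenteredMaximal f (i.insertNth t m)) ≤
      ENNReal.ofReal (2 * ∑' q, lineMass f i m q) := by
  have hF := lineMass_nonneg f i m
  have hs := summable_lineMass hf i m
  have hg (t : ℤ) : 0 ≤ uncenteredMaximal f (i.insertNth t m) := uncenteredMaximal_nonneg f _
  refine ((intervalCharging_leftMass_sub_single (p := 0) (q := 0) (i := i) hF hs hg le_rfl (hF 0)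
    (hF 0) (by simp) fun a => ?_).lineVariation_le_two_mul_tsum_sub hF hs hg (hF 0)).trans_eq
      (by rw [sub_zero])
  obtain ⟨u, v, ha, hline, hmax, hmass⟩ := exists_maximizing_box_of_line hf i m a
  have hle := hmax.trans_le (Finset.sum_le_sum hmass)
  exact ⟨u i, v i, Finset.Icc u v, ha, fun t ht => (hline t ht).2,
    fun q hq => apply_mem_Icc_of_mem_Icc hq i, hle, fun _ _ => by rwa [add_zero]⟩

/- `p` carries its full mass `|f p|` on its own line, whereas an average over at least two points
uses at most half of it. -/
theorem average_add_half_le_sum_lineMass {i : Fin (e + 1)} {p : Fin (e + 1) → ℤ}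
    {Q : Finset (Fin (e + 1) → ℤ)} (hp : p ∈ Q) (hcard : 1 < Q.card)
    (hmass : ∀ q ∈ Q, |f q| / Q.card ≤ lineMass f i (i.removeNth p) q) :
    ∑ q ∈ Q, |f q| / Q.card + |f p| / 2 ≤ ∑ q ∈ Q, lineMass f i (i.removeNth p) q := by
  have hhalf : |f p| / Q.card ≤ |f p| / 2 := by
    gcongr
    exact_mod_cast hcard
  have hrest : ∑ q ∈ Q.erase p, |f q| / Q.card ≤ ∑ q ∈ Q.erase p, lineMass f i (i.removeNth p) q :=
    Finset.sum_le_sum fun q hq => hmass q (Finset.mem_of_mem_erase hq)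
  rw [← Finset.add_sum_erase _ _ hp, ← Finset.add_sum_erase _ _ hp, lineMass_removeNth_self]
  linarith

theorem lineVariation_uncenteredMaximal_lt (hf : Summable fun q => |f q|) {i : Fin (e + 1)}
    {p q : Fin (e + 1) → ℤ} (hp : f p ≠ 0) (hq : f q ≠ 0) (hpq : p i < q i) :
    lineVariation (fun t => uncenteredMaximal f (i.insertNth t (i.removeNth p))) <
      ENNReal.ofReal (2 * ∑' z, lineMass f i (i.removeNth p) z) := by
  let m := i.removeNth p
  let g (t : ℤ) := uncenteredMaximal f (i.insertNth t m)
  have hg (t : ℤ) : 0 ≤ g t := uncenteredMaximal_nonneg f _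
  have hF := lineMass_nonneg f i m
  have hs := summable_lineMass hf i m
  have hFq : 0 < lineMass f i m q := mul_pos (abs_pos.mpr hq) (lineWeight_pos _)
  obtain ⟨t₀, -, ht₀⟩ := Finset.exists_min_image (Finset.Icc (p i) (q i)) g
    ⟨p i, Finset.left_mem_Icc.mpr hpq.le⟩
  obtain ⟨δ, hδ, hδ_lt⟩ := exists_between <|
    lt_min (uncenteredMaximal_pos hf hp (i.insertNth t₀ m)) (lt_min hFq (half_pos (abs_pos.mpr hp)))
  simp only [lt_min_iff] at hδ_lt
  obtain ⟨hδg, hδq, hδp⟩ := hδ_lt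
  have hFp : δ ≤ lineMass f i m p := by
    rw [lineMass_removeNth_self]
    linarith
  refine ((intervalCharging_leftMass_sub_single (i := i) hF hs hg hδ.le hFp hδq.le
    (fun t ht => ?_) fun a => ?_).lineVariation_le_two_mul_tsum_sub hF hs hg hδq.le).trans_lt <|
      (ENNReal.ofReal_lt_ofReal_iff ?_).mpr (by linarith)
  · exact hδg.le.trans (ht₀ t (Finset.mem_Icc.mpr ⟨ht.1.le, ht.2⟩))
  · obtain ⟨u, v, ha, hline, hmax, hmass⟩ := exists_maximizing_box_of_line hf i m a
    refine ⟨u i, v i, Finset.Icc u v, ha, fun t ht => (hline t ht).2,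
      fun z hz => apply_mem_Icc_of_mem_Icc hz i, hmax.trans_le (Finset.sum_le_sum hmass),
      fun hup hqv => ?_⟩
    have hpQ : p ∈ Finset.Icc u v := by
      simpa [m] using (hline (p i) ⟨hup, hpq.le.trans hqv⟩).1
    have hqQ : i.insertNth (q i) m ∈ Finset.Icc u v := (hline (q i) ⟨hup.trans hpq.le, hqv⟩).1
    have hcard : 1 < (Finset.Icc u v).card := Finset.one_lt_card.mpr
      ⟨p, hpQ, _, hqQ, fun heq => hpq.ne (by simpa using congrFun heq i)⟩
    linarith [average_add_half_le_sum_lineMass hpQ hcard hmass]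
  · exact mul_pos two_pos (hs.tsum_pos hF q hFq)

end AxisParallelLines

section DeltaFunctions

theorem ofReal_le_tsum_abs_sub {h : ℕ → ℝ} (hlim : Filter.Tendsto h Filter.atTop (nhds 0)) :
    ENNReal.ofReal (h 0) ≤ ∑' n : ℕ, ENNReal.ofReal |h (n + 1) - h n| := by
  have hedist : edist (h 0) 0 ≤ ∑' n : ℕ, ENNReal.ofReal |h (n + 1) - h n| :=
    edist_le_tsum_of_edist_le_of_tendsto₀ _
      (fun n => by rw [edist_comm, edist_dist, Real.dist_eq]) hlim
  rw [edist_dist, Real.dist_eq, sub_zero] at hedist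
  exact (ENNReal.ofReal_le_ofReal (le_abs_self _)).trans hedist

theorem two_mul_ofReal_le_lineVariation {g : ℤ → ℝ} (s : ℤ)
    (htop : Filter.Tendsto (fun n : ℕ => g (s + n)) Filter.atTop (nhds 0))
    (hbot : Filter.Tendsto (fun n : ℕ => g (s - n)) Filter.atTop (nhds 0)) :
    2 * ENNReal.ofReal (g s) ≤ lineVariation g := by
  have hright := ofReal_le_tsum_abs_sub htop
  have hleft := ofReal_le_tsum_abs_sub hbot
  rw [Nat.cast_zero, add_zero] at hright
  rw [Nat.cast_zero, sub_zero] at hleft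
  rw [lineVariation, ← (Equiv.addLeft s).tsum_eq, (HasSum.of_nat_of_neg_add_one
    ENNReal.summable.hasSum ENNReal.summable.hasSum).tsum_eq, two_mul]
  refine add_le_add (hright.trans_eq (tsum_congr fun n => ?_))
    (hleft.trans_eq (tsum_congr fun n => ?_))
  · rw [Equiv.coe_addLeft, Nat.cast_succ, add_assoc]
  · rw [abs_sub_comm, Nat.cast_succ]
    simp [sub_eq_add_neg, add_assoc]

theorem uncenteredMaximal_le_of_forall_ne {d : ℕ} {f : (Fin d → ℤ) → ℝ} {p : Fin d → ℤ}
    (hf : Summable fun q => |f q|) (hp : ∀ q, q ≠ p → f q = 0) (n : Fin d → ℤ) (j : Fin d) :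
    uncenteredMaximal f n ≤ |f p| * (1 / ((n j - p j).natAbs + 1)) := by
  obtain ⟨k, u, v, -, hn, hmax⟩ :=
    mem_cubeAverages_iff.mp (uncenteredMaximal_mem_cubeAverages hf n)
  rw [hmax, mul_one_div]
  by_cases hpQ : p ∈ Finset.Icc u v
  · rw [Finset.sum_eq_single_of_mem p hpQ fun q _ hq => by rw [hp q hq, abs_zero]]
    gcongr
    exact_mod_cast natAbs_sub_lt_card_Icc hpQ hn j
  · rw [Finset.sum_eq_zero fun q hq => by rw [hp q (ne_of_mem_of_not_mem hq hpQ), abs_zero],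
      zero_div]
    positivity

variable {e : ℕ} {f : (Fin (e + 1) → ℤ) → ℝ} {p : Fin (e + 1) → ℤ}

theorem tendsto_uncenteredMaximal_of_forall_ne (hf : Summable fun q => |f q|)
    (hp : ∀ q, q ≠ p → f q = 0) (i : Fin (e + 1)) (m : Fin e → ℤ) {s : ℕ → ℤ}
    (hs : ∀ n, (s n - p i).natAbs = n) :
    Filter.Tendsto (fun n => uncenteredMaximal f (i.insertNth (s n) m)) Filter.atTop (nhds 0) := by
  have hzero := (tendsto_one_div_add_atTop_nhds_zero_nat (𝕜 := ℝ)).const_mul |f p|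
  rw [mul_zero] at hzero
  refine squeeze_zero (fun n => uncenteredMaximal_nonneg f _) (fun n => ?_) hzero
  simpa [hs] using uncenteredMaximal_le_of_forall_ne hf hp (i.insertNth (s n) m) i

theorem two_mul_lineMass_le_lineVariation (hf : Summable fun q => |f q|)
    (hp : ∀ q, q ≠ p → f q = 0) (i : Fin (e + 1)) (m : Fin e → ℤ) :
    ENNReal.ofReal (2 * lineMass f i m p) ≤
      lineVariation fun t => uncenteredMaximal f (i.insertNth t m) := by
  rw [ENNReal.ofReal_mul zero_le_two, ENNReal.ofReal_ofNat, lineMass_eq_div_minCubeCard]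
  refine le_trans ?_ (two_mul_ofReal_le_lineVariation (p i)
    (tendsto_uncenteredMaximal_of_forall_ne hf hp i m fun n => by omega)
    (tendsto_uncenteredMaximal_of_forall_ne hf hp i m fun n => by omega))
  gcongr
  exact div_minCubeCard_le_uncenteredMaximal hf p _

end DeltaFunctions

section TotalVariation

variable {e : ℕ} {f : (Fin (e + 1) → ℤ) → ℝ} {p q : Fin (e + 1) → ℤ}

theorem tsum_tsum_lineMass (hf : Summable fun q => |f q|) (i : Fin (e + 1)) :
    ∑' m, ENNReal.ofReal (2 * ∑' q, lineMass f i m q) =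
      ENNReal.ofReal (2 * (1 + ∑' k, sharpConstTerm (e + 1) k) * ∑' q, |f q|) := by
  have hpoint (q : Fin (e + 1) → ℤ) : ∑' m, ENNReal.ofReal (lineMass f i m q) =
      ENNReal.ofReal |f q| * ENNReal.ofReal (1 + ∑' k, sharpConstTerm (e + 1) k) := by
    simp_rw [lineMass, ENNReal.ofReal_mul (abs_nonneg _)]
    rw [ENNReal.tsum_mul_left, ← tsum_lineWeight,
      ← (Equiv.subRight (i.removeNth q)).tsum_eq fun m => ENNReal.ofReal (lineWeight m)]
    rfl
  have hconst : 0 ≤ 1 + ∑' k, sharpConstTerm (e + 1) k :=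
    add_nonneg zero_le_one (tsum_nonneg (sharpConstTerm_nonneg _))
  simp_rw [ENNReal.ofReal_mul zero_le_two,
    ENNReal.ofReal_tsum_of_nonneg (lineMass_nonneg f i _) (summable_lineMass hf i _)]
  rw [ENNReal.tsum_mul_left, ENNReal.tsum_comm, tsum_congr hpoint, ENNReal.tsum_mul_right,
    ← ENNReal.ofReal_tsum_of_nonneg (fun _ => abs_nonneg _) hf, mul_assoc,
    ENNReal.ofReal_mul zero_le_two, ENNReal.ofReal_mul hconst, mul_comm (ENNReal.ofReal (∑' q, _))]

theorem sum_tsum_tsum_lineMass (hf : Summable fun q => |f q|) :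
    ∑ i, ∑' m, ENNReal.ofReal (2 * ∑' q, lineMass f i m q) =
      ENNReal.ofReal (sharpConst (e + 1) * ∑' q, |f q|) := by
  rw [Finset.sum_congr rfl fun i _ => tsum_tsum_lineMass hf i, Finset.sum_const, Finset.card_univ,
    Fintype.card_fin, ← ENNReal.ofReal_nsmul, nsmul_eq_mul, sharpConst]
  congr 1
  ring

theorem totalVariation_uncenteredMaximal_le (hf : Summable fun q => |f q|) :
    totalVariation (uncenteredMaximal f) ≤ ENNReal.ofReal (sharpConst (e + 1) * ∑' q, |f q|) := by
  rw [totalVariation_eq_sum_lineVariation, ← sum_tsum_tsum_lineMass hf]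
  exact Finset.sum_le_sum fun i _ => ENNReal.tsum_le_tsum fun m =>
    lineVariation_uncenteredMaximal_le hf i m

theorem totalVariation_uncenteredMaximal_lt (hf : Summable fun q => |f q|) (hp : f p ≠ 0)
    (hq : f q ≠ 0) {i : Fin (e + 1)} (hpq : p i < q i) :
    totalVariation (uncenteredMaximal f) < ENNReal.ofReal (sharpConst (e + 1) * ∑' q, |f q|) := by
  have hfin := ((totalVariation_uncenteredMaximal_le hf).trans_lt ENNReal.ofReal_lt_top).ne
  rw [totalVariation_eq_sum_lineVariation] at hfin ⊢
  have hline (j : Fin (e + 1)) (m : Fin e → ℤ) := lineVariation_uncenteredMaximal_le hf j m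
  have haxis := ENNReal.tsum_lt_tsum (ENNReal.sum_ne_top.mp hfin i (Finset.mem_univ i)) (hline i)
    (lineVariation_uncenteredMaximal_lt hf hp hq hpq)
  rw [← sum_tsum_tsum_lineMass hf]
  simp only [← tsum_fintype (L := .unconditional _)] at hfin ⊢
  exact ENNReal.tsum_lt_tsum hfin (fun j => ENNReal.tsum_le_tsum (hline j)) haxis

theorem totalVariation_uncenteredMaximal_eq_of_isDeltaFunction (hf : Summable fun q => |f q|)
    (hδ : IsDeltaFunction f) :
    totalVariation (uncenteredMaximal f) = ENNReal.ofReal (sharpConst (e + 1) * ∑' q, |f q|) := by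
  obtain ⟨p, -, -, hp⟩ := hδ
  have hmass (i : Fin (e + 1)) (m : Fin e → ℤ) : ∑' q, lineMass f i m q = lineMass f i m p :=
    tsum_eq_single p fun q hq => by rw [lineMass, hp q hq, abs_zero, zero_mul]
  refine (totalVariation_uncenteredMaximal_le hf).antisymm ?_
  rw [totalVariation_eq_sum_lineVariation, ← sum_tsum_tsum_lineMass hf]
  refine Finset.sum_le_sum fun i _ => ENNReal.tsum_le_tsum fun m => ?_
  rw [hmass]
  exact two_mul_lineMass_le_lineVariation hf hp i m

theorem exists_ne_zero_and_apply_lt {d : ℕ} {f : (Fin d → ℤ) → ℝ} (hδ : ¬IsDeltaFunction f) :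
    ∃ p q i, f p ≠ 0 ∧ f q ≠ 0 ∧ p i < q i := by
  have hne (p : Fin d → ℤ) : ∃ q, q ≠ p ∧ f q ≠ 0 := by
    by_contra! hzero
    exact hδ ⟨p, f p, rfl, hzero⟩
  obtain ⟨p, -, hp⟩ := hne 0
  obtain ⟨q, hqp, hq⟩ := hne p
  obtain ⟨i, hi⟩ := Function.ne_iff.mp hqp
  rcases hi.lt_or_gt with hlt | hgt
  · exact ⟨q, p, i, hq, hp, hlt⟩
  · exact ⟨p, q, i, hp, hq, hgt⟩

theorem totalVariation_uncenteredMaximal_eq_iff (hf : Summable fun q => |f q|) :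
    totalVariation (uncenteredMaximal f) = ENNReal.ofReal (sharpConst (e + 1) * ∑' q, |f q|) ↔
      IsDeltaFunction f := by
  refine ⟨fun heq => ?_, totalVariation_uncenteredMaximal_eq_of_isDeltaFunction hf⟩
  by_contra hδ
  obtain ⟨p, q, i, hp, hq, hpq⟩ := exists_ne_zero_and_apply_lt hδ
  exact (totalVariation_uncenteredMaximal_lt hf hp hq hpq).ne heq

end TotalVariation

section SequenceSpace

variable {α : Type*}

theorem summable_abs_lp (f : lp (fun _ : α => ℝ) 1) : Summable fun q => |f q| := by
  simpa using (lp.memℓp f).summable (by norm_num)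

theorem norm_lp_one_eq_tsum_abs (f : lp (fun _ : α => ℝ) 1) : ‖f‖ = ∑' q, |f q| := by
  rw [lp.norm_eq_tsum_rpow (by norm_num)]
  simp

theorem isDeltaFunction_single {d : ℕ} (p : Fin d → ℤ) (k : ℝ) :
    IsDeltaFunction (lp.single (E := fun _ : Fin d → ℤ => ℝ) 1 p k) :=
  ⟨p, k, lp.single_apply_self _ _ _, fun _ hn => lp.single_apply_ne _ _ _ hn⟩

end SequenceSpace

theorem theorem3 :
    (∀ d : ℕ, 1 ≤ d →
      -- the series defining the constant converges
      Summable (sharpConstTerm d) ∧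
      -- the inequality
      (∀ f : lp (fun _ : Fin d → ℤ => ℝ) 1,
        totalVariation (uncenteredMaximal f) ≤ ENNReal.ofReal (sharpConst d * ‖f‖)) ∧
      -- the constant is the best possible
      (∀ C : ℝ, (∀ f : lp (fun _ : Fin d → ℤ => ℝ) 1,
        totalVariation (uncenteredMaximal f) ≤ ENNReal.ofReal (C * ‖f‖)) → sharpConst d ≤ C) ∧
      -- the equality case
      (∀ f : lp (fun _ : Fin d → ℤ => ℝ) 1,
        totalVariation (uncenteredMaximal f) = ENNReal.ofReal (sharpConst d * ‖f‖) ↔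
          IsDeltaFunction f)) ∧
    sharpConst 1 = 2 ∧ sharpConst 2 = 12 := by
  refine ⟨fun d hd => ?_, sharpConst_one, sharpConst_two⟩
  obtain ⟨e, rfl⟩ := Nat.exists_eq_add_of_le' hd
  simp only [norm_lp_one_eq_tsum_abs]
  refine ⟨summable_sharpConstTerm _,
    fun f => totalVariation_uncenteredMaximal_le (summable_abs_lp f), fun C hC => ?_,
    fun f => totalVariation_uncenteredMaximal_eq_iff (summable_abs_lp f)⟩
  let f : lp (fun _ : Fin (e + 1) → ℤ => ℝ) 1 := lp.single 1 0 1
  have hnorm : ∑' q, |f q| = 1 := by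
    rw [← norm_lp_one_eq_tsum_abs, lp.norm_single one_pos, norm_one]
  have hle := (totalVariation_uncenteredMaximal_eq_of_isDeltaFunction (summable_abs_lp f)
    (isDeltaFunction_single 0 1)).symm.trans_le (hC f)
  rw [hnorm, mul_one, mul_one] at hle
  by_contra! hlt
  exact hle.not_gt ((ENNReal.ofReal_lt_ofReal_iff (sharpConst_pos hd)).mpr hlt)
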